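/- Let $V$ be a set and $w:V\times V\to[0,\infty)$ a symmetric weight with $w(v,v)=0$ for all $v$ (an undirected weighted graph). For $A\subset V$ and $v\in V$ put $w_A(v)=\sum_{u\in A}w(u,v)\in[0,\infty]$. Let $L_w$ be the weighted Laplacian in $\ell^2(V)$ (complex-valued functions), $$(L_wf)(v)=\sum_{u\in V}(f(v)-f(u))\,w(v,u),$$ on its maximal domain (all $f\in\ell^2(V)$ for which these sums converge absolutely and $L_wf\in\ell^2(V)$), and assume that $L_w$ is self-adjoint (it may be unbounded). For $\omega\ge 0$ let $PW_\omega(L_w)$ be the range of the spectral projection $\mathbf 1_{[0,\omega]}(L_w)$, and let $\theta_v$ be the orthogonal projection of the Dirac function $\delta_v$ onto $PW_\omega(L_w)$. Let $S_0\subsetneq V$, $S_1=V\setminus S_0$, and $$D_0=\sup_{v\in S_0}w_{S_1}(v),\quad K_0=\inf_{v\in S_1}w_{S_0}(v),\quad \widehat D_0=\sup_{v\in S_1}w_{S_0}(v),\quad \widehat K_0=\inf_{v\in S_0}w_{S_1}(v).$$ Assume $0\le\omega<K_0/2$ and put $$A=\frac{\left(1-\sqrt{2\omega/K_0}\right)^2}{1+D_0/K_0},\qquad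 B=\frac{\left(1+\sqrt{2\omega/\widehat D_0}\right)^2}{1+\widehat K_0/\widehat D_0}$$ (so $A=0$ if $D_0=\infty$, and $B=1$ if $\widehat D_0=\infty$). Then: 1. $0\le A\le B$, $0<B<\infty$, and $A>0$ if $D_0<\infty$. 2. The functions $\theta_v$, $v\in S_0$, lie in $PW_\omega(L_w)$, and for every $f\in PW_\omega(L_w)$ one has $\langle f,\theta_v\rangle=f(v)$ for $v\in S_0$ and $$A\|f\|_2^2\le\sum_{v\in S_0}|\langle f,\theta_v\rangle|^2\le B\|f\|_2^2 .$$ In particular, if $D_0<\infty$, then $S_0$ is a sampling set for $PW_\omega(L_w)$. 3. For $f\in PW_\omega(L_w)$ and a relaxation parameter $\tau$ let $g_0=0$ and $$g_n=g_{n-1}+\tau\sum_{v\in S_0}(f-g_{n-1})(v)\,\theta_v\qquad(n\ge1),$$ where the series converges unconditionally in $\ell^2(V)$. If $0<\tau<2/B$, then for all $n\ge0$ $$\|f-g_n\|_2\le\max\{|1-\tau A|,|1-\tau B|\}^n\,\|f\|_2 .$$ If $\tau=\frac{2}{A+B}$, then for all $n\ge0$ $$\|f-g_n\|_2\le\eta^n\|f\|_2,\qquad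 \eta=\frac{B-A}{A+B}.$$ -/

import Mathlib

open scoped ENNReal

noncomputable section

/-! ### Spectral measures of (possibly unbounded) self-adjoint operators -/

/-- A projection-valued measure on the Borel sets of `ℝ`, with values in the orthogonal projections
of the Hilbert space `H` (only the values on measurable sets are meaningful). -/
structure ProjectionValuedMeasure (H : Type*) [NormedAddCommGroup H] [InnerProductSpace ℂ H]
    [CompleteSpace H] where
  proj : Set ℝ → H →L[ℂ] H
  isStarProjection' : ∀ s, MeasurableSet s → IsStarProjection (proj s)
  empty' : proj ∅ = 0
  univ' : proj Set.univ = 1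
  inter' : ∀ s t, MeasurableSet s → MeasurableSet t → proj (s ∩ t) = proj s * proj t
  hasSum_iUnion' : ∀ s : ℕ → Set ℝ, (∀ i, MeasurableSet (s i)) →
    Pairwise (Function.onFun Disjoint s) → ∀ x : H, HasSum (fun i => proj (s i) x) (proj (⋃ i, s i) x)

namespace ProjectionValuedMeasure

variable {H : Type*} [NormedAddCommGroup H] [InnerProductSpace ℂ H] [CompleteSpace H]

theorem norm_sq_proj (E : ProjectionValuedMeasure H) {s : Set ℝ} (hs : MeasurableSet s) (x : H) :
    ‖E.proj s x‖ ^ 2 = (inner ℂ x (E.proj s x)).re := by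
  have h := E.isStarProjection' s hs
  have h1 : E.proj s (E.proj s x) = E.proj s x := by
    have := congrArg (fun T : H →L[ℂ] H => T x) h.isIdempotentElem
    simpa using this
  have h2 : inner ℂ (E.proj s x) (E.proj s x) = inner ℂ x (E.proj s (E.proj s x)) := by
    have := ContinuousLinearMap.adjoint_inner_left (E.proj s) (E.proj s x) x
    rwa [← ContinuousLinearMap.star_eq_adjoint, h.isSelfAdjoint.star_eq] at this
  rw [h1] at h2
  rw [← h2, ← inner_self_eq_norm_sq (𝕜 := ℂ)]
  rfl

/-- The scalar measure `s ↦ ⟨x, E(s) x⟩ = ‖E(s) x‖²` attached to a vector `x`. -/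
def scalarMeasure (E : ProjectionValuedMeasure H) (x : H) : MeasureTheory.Measure ℝ :=
  MeasureTheory.Measure.ofMeasurable (fun s _ => ENNReal.ofReal (‖E.proj s x‖ ^ 2))
    (by simp [E.empty'])
    (by
      intro s hs hd
      have h := E.hasSum_iUnion' s hs hd x
      have h2 : HasSum (fun i => ‖E.proj (s i) x‖ ^ 2) (‖E.proj (⋃ i, s i) x‖ ^ 2) := by
        have h3 := (h.mapL (innerSL ℂ x)).mapL Complex.reCLM
        rw [E.norm_sq_proj (MeasurableSet.iUnion hs) x]
        refine h3.congr_fun ?_ 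
        intro i
        simp [E.norm_sq_proj (hs i) x]
      rw [← h2.tsum_eq, ENNReal.ofReal_tsum_of_nonneg (fun i => by positivity) h2.summable])

/-- `E` is the spectral measure of the operator `T`, i.e. `T = ∫ t dE(t)`: the domain of `T` is
`{x | ∫ t² d⟨x, E(t) x⟩ < ∞}` and `⟨x, T x⟩ = ∫ t d⟨x, E(t) x⟩` on the domain. -/
def IsSpectralMeasureOf (E : ProjectionValuedMeasure H) (T : H →ₗ.[ℂ] H) : Prop :=
  (∀ x : H, x ∈ T.domain ↔ ∫⁻ t, ENNReal.ofReal (t ^ 2) ∂(E.scalarMeasure x) < ∞) ∧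
    ∀ x : T.domain, inner ℂ (x : H) (T x) = ∫ t, (t : ℂ) ∂(E.scalarMeasure (x : H))

end ProjectionValuedMeasure

open Classical in
/-- The spectral projection `1_s(T)` of a self-adjoint operator `T`, i.e. the value at `s` of the
spectral measure of `T`, which exists and is unique by the spectral theorem (the value is `0` by
convention for an operator that has no spectral measure, which is never self-adjoint). -/
def spectralProjection {H : Type*} [NormedAddCommGroup H] [InnerProductSpace ℂ H] [CompleteSpace H]
    (T : H →ₗ.[ℂ] H) (s : Set ℝ) : H →L[ℂ] H :=
  if h : ∃ E : ProjectionValuedMeasure H, E.IsSpectralMeasureOf T then h.choose.proj s else 0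

theorem isStarProjection_spectralProjection {H : Type*} [NormedAddCommGroup H]
    [InnerProductSpace ℂ H] [CompleteSpace H] (T : H →ₗ.[ℂ] H) {s : Set ℝ} (hs : MeasurableSet s) :
    IsStarProjection (spectralProjection T s) := by
  unfold spectralProjection
  split_ifs with h
  · exact h.choose.isStarProjection' s hs
  · exact IsStarProjection.zero _

/-! ### Weighted graphs and the weighted Laplacian -/

/-- An undirected weighted graph on `V`: the edges are the pairs with nonzero weight. -/
structure WeightedGraph (V : Type*) where
  w : V → V → ℝ
  nonneg : ∀ u v, 0 ≤ w u v
  symm : ∀ u v, w u v = w v u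
  loopless : ∀ v, w v v = 0

/-- The Hilbert space `ℓ²(V)` of square-summable complex functions. -/
abbrev Ell2 (V : Type*) : Type _ := lp (fun _ : V => ℂ) 2

namespace WeightedGraph

variable {V : Type*} (G : WeightedGraph V)

/-- `w_A(v) = ∑_{u ∈ A} w(u, v)`. -/
def weightTo (A : Set V) (v : V) : ℝ≥0∞ := ∑' u : A, ENNReal.ofReal (G.w u v)

/-- `D₀ = sup_{v ∈ S₀} w_{S₁}(v)`, where `S₁ = V ∖ S₀`. -/
def D (S : Set V) : ℝ≥0∞ := ⨆ v ∈ S, G.weightTo Sᶜ v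

/-- `K₀ = inf_{v ∈ S₁} w_{S₀}(v)`, where `S₁ = V ∖ S₀`. -/
def K (S : Set V) : ℝ≥0∞ := ⨅ v ∈ Sᶜ, G.weightTo S v

/-- `D̂₀ = sup_{v ∈ S₁} w_{S₀}(v)`, where `S₁ = V ∖ S₀`. -/
def Dhat (S : Set V) : ℝ≥0∞ := ⨆ v ∈ Sᶜ, G.weightTo S v

/-- `K̂₀ = inf_{v ∈ S₀} w_{S₁}(v)`, where `S₁ = V ∖ S₀`. -/
def Khat (S : Set V) : ℝ≥0∞ := ⨅ v ∈ S, G.weightTo Sᶜ v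

/-- `A = (1 - √(2ω/K₀))² / (1 + D₀/K₀)`, which is `0` if `D₀ = ∞`. -/
def lowerBound (S : Set V) (ω : ℝ) : ℝ :=
  (1 - √((ENNReal.ofReal (2 * ω) / G.K S).toReal)) ^ 2 * ((1 + G.D S / G.K S)⁻¹).toReal

/-- `B = (1 + √(2ω/D̂₀))² / (1 + K̂₀/D̂₀)`, which is `1` if `D̂₀ = ∞`. -/
def upperBound (S : Set V) (ω : ℝ) : ℝ :=
  (1 + √((ENNReal.ofReal (2 * ω) / G.Dhat S).toReal)) ^ 2 *
    ((1 + G.Khat S / G.Dhat S)⁻¹).toReal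

/-- The function `(L_w f)(v) = ∑_u (f(v) - f(u)) w(v, u)`. -/
def laplacianFun (f : V → ℂ) (v : V) : ℂ := ∑' u, (f v - f u) * (G.w v u : ℂ)

/-- The weighted Laplacian `L_w` as an operator in `ℓ²(V)`, on its maximal domain: all `f ∈ ℓ²(V)`
for which the sums defining `L_w f` converge and `L_w f ∈ ℓ²(V)`. -/
def laplacian : Ell2 V →ₗ.[ℂ] Ell2 V where
  domain :=
    { carrier := {f | (∀ v, Summable fun u => (f v - f u) * (G.w v u : ℂ)) ∧
        Memℓp (G.laplacianFun f) 2}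
      zero_mem' := by
        refine ⟨fun v => by simp, ?_⟩
        have : G.laplacianFun ((0 : Ell2 V) : V → ℂ) = 0 := by
          funext v; simp [laplacianFun]
        rw [this]; exact zero_memℓp
      add_mem' := by
        rintro f g ⟨hf, hf'⟩ ⟨hg, hg'⟩
        have e : ∀ v, (fun u => ((f + g : Ell2 V) v - (f + g : Ell2 V) u) * (G.w v u : ℂ)) =
            fun u => (f v - f u) * (G.w v u : ℂ) + (g v - g u) * (G.w v u : ℂ) := by
          intro v; funext u; simp only [lp.coeFn_add, Pi.add_apply]; ring
        refine ⟨fun v => by rw [e v]; exact (hf v).add (hg v), ?_⟩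
        have : G.laplacianFun ((f + g : Ell2 V) : V → ℂ) =
            G.laplacianFun f + G.laplacianFun g := by
          funext v
          simp only [laplacianFun, Pi.add_apply]
          rw [e v]; exact (hf v).tsum_add (hg v)
        rw [this]; exact hf'.add hg'
      smul_mem' := by
        rintro c f ⟨hf, hf'⟩
        have e : ∀ v, (fun u => ((c • f : Ell2 V) v - (c • f : Ell2 V) u) * (G.w v u : ℂ)) =
            fun u => c * ((f v - f u) * (G.w v u : ℂ)) := by
          intro v; funext u; simp only [lp.coeFn_smul, Pi.smul_apply, smul_eq_mul]; ring
        refine ⟨fun v => by rw [e v]; exact (hf v).mul_left c, ?_⟩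
        have : G.laplacianFun ((c • f : Ell2 V) : V → ℂ) = c • G.laplacianFun f := by
          funext v
          simp only [laplacianFun, Pi.smul_apply, smul_eq_mul]
          rw [e v]; exact tsum_mul_left
        rw [this]; exact hf'.const_smul c }
  toFun :=
    { toFun := fun f => ⟨G.laplacianFun (f : Ell2 V), f.2.2⟩
      map_add' := by
        rintro ⟨f, hf, hf'⟩ ⟨g, hg, hg'⟩
        apply lp.ext
        funext v
        change G.laplacianFun ((f + g : Ell2 V) : V → ℂ) v =
          G.laplacianFun f v + G.laplacianFun g v
        simp only [laplacianFun]
        rw [← (hf v).tsum_add (hg v)]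
        refine tsum_congr fun u => ?_
        simp only [lp.coeFn_add, Pi.add_apply]; ring
      map_smul' := by
        rintro c ⟨f, hf, hf'⟩
        apply lp.ext
        funext v
        change G.laplacianFun ((c • f : Ell2 V) : V → ℂ) v = c * G.laplacianFun f v
        simp only [laplacianFun]
        rw [← tsum_mul_left]
        refine tsum_congr fun u => ?_
        simp only [lp.coeFn_smul, Pi.smul_apply, smul_eq_mul]; ring }

/-! ### Paley–Wiener spaces and the frame algorithm -/

/-- The orthogonal projection `1_{[0, ω]}(L_w)`. -/
def pwProjection (ω : ℝ) : Ell2 V →L[ℂ] Ell2 V := spectralProjection G.laplacian (Set.Icc 0 ω)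

/-- The Paley–Wiener space `PW_ω(L_w)`, the range of `1_{[0, ω]}(L_w)`. -/
def paleyWiener (ω : ℝ) : Submodule ℂ (Ell2 V) := (G.pwProjection ω).range

open Classical in
/-- `θ_v`, the orthogonal projection of the Dirac function `δ_v` onto `PW_ω(L_w)`. -/
def theta (ω : ℝ) (v : V) : Ell2 V := G.pwProjection ω (lp.single 2 v 1)

/-- The iterates of the frame algorithm with relaxation parameter `τ`: `g₀ = 0` and
`g_{n+1} = g_n + τ ∑_{v ∈ S₀} (f - g_n)(v) θ_v`. -/
def frameIterate (ω : ℝ) (S : Set V) (τ : ℝ) (f : Ell2 V) : ℕ → Ell2 V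
  | 0 => 0
  | n + 1 => frameIterate ω S τ f n +
      (τ : ℂ) • ∑' v : S, (f - frameIterate ω S τ f n : Ell2 V) v • G.theta ω v

end WeightedGraph

end

/-!
A vector of the Paley–Wiener space lies in the domain of the Laplacian `L`, and `⟨f, L f⟩ ≤ ω ‖f‖²`,
because its scalar spectral measure lives on `[0, ω]` (`mem_domain_and_norm_inner_le`). This uses
nothing about the spectral measure beyond its defining properties; an operator without one would
have a zero space by convention.

The quadratic form is then turned into the energy of `f`, that is, `∑ w(x, y) |f(x) - f(y)|²` over
unordered pairs (`exists_isGradient_norm_sq_eq`). On the maximal domain this is not immediate. Since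
`L` is densely defined, every vertex has finite degree, so Dirac functions have finite energy.
Projecting `(h, 0)` onto the closed graph of the gradient solves `(L + 1) g = h` with a `g` that has
finite energy and satisfies Green's formula. As `L` is symmetric and `L + 1` is already surjective
on such functions, `L + 1` is injective, and these functions exhaust the domain of `L`.

The frame bounds come from the edges between `S₀` and `S₁`. In the weighted `ℓ²` space of these
edges, Minkowski's inequality gives `√K₀ ‖f|S₁‖ ≤ √D₀ ‖f|S₀‖ + √(2ω) ‖f‖`, and with exchanged roles
`√K̂₀ ‖f|S₀‖ ≤ √D̂₀ ‖f|S₁‖ + √(2ω) ‖f‖` (`sqrt_mul_norm_restrict_le`). Together with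
`‖f‖² = ‖f|S₀‖² + ‖f|S₁‖²` they give `A` and `B` by plane geometry.

The frame algorithm multiplies the error by `1 - τ P R†R`, where `P` is the projection onto the
Paley–Wiener space and `R` the restriction to `S₀`. This operator is self-adjoint, so its norm is
the supremum of its Rayleigh quotients, which lie between `1 - τ B` and `1 - τ A`
(`norm_sub_smul_le_of_frame_bounds`).
-/

open scoped InnerProductSpace

/-! ### Square-summable functions -/

namespace Ell2

variable {ι : Type*}

theorem memℓp_iff_summable {f : ι → ℂ} : Memℓp f 2 ↔ Summable fun i => ‖f i‖ ^ 2 := by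
  rw [memℓp_gen_iff (by simp)]
  simp

theorem hasSum_norm_sq (f : Ell2 ι) : HasSum (fun i => ‖f i‖ ^ 2) (‖f‖ ^ 2) := by
  simpa using lp.hasSum_norm (p := 2) (by simp) f

theorem tsum_enorm_sq (f : Ell2 ι) : ∑' i, ‖f i‖ₑ ^ 2 = ENNReal.ofReal (‖f‖ ^ 2) := by
  rw [← (hasSum_norm_sq f).tsum_eq,
    ENNReal.ofReal_tsum_of_nonneg (fun i => by positivity) (hasSum_norm_sq f).summable]
  refine tsum_congr fun i => ?_
  rw [← ofReal_norm, ENNReal.ofReal_pow (norm_nonneg _)]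

theorem memℓp_of_tsum_ne_top {f : ι → ℂ} (h : ∑' i, ‖f i‖ₑ ^ 2 ≠ ∞) : Memℓp f 2 := by
  rw [memℓp_iff_summable]
  refine (ENNReal.summable_toReal h).congr fun i => ?_
  simp

/-- Restriction of square-summable functions to a subset, as a linear map. -/
def restrictₗ (S : Set ι) : Ell2 ι →ₗ[ℂ] Ell2 S where
  toFun f := ⟨fun v => f v,
    memℓp_iff_summable.2 ((hasSum_norm_sq f).summable.comp_injective Subtype.val_injective)⟩
  map_add' _ _ := rfl
  map_smul' _ _ := rfl

theorem norm_restrictₗ_le (S : Set ι) (f : Ell2 ι) : ‖restrictₗ S f‖ ≤ 1 * ‖f‖ := by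
  rw [one_mul, ← sq_le_sq₀ (norm_nonneg _) (norm_nonneg _), ← (hasSum_norm_sq _).tsum_eq,
    ← (hasSum_norm_sq f).tsum_eq]
  exact (hasSum_norm_sq f).summable.tsum_subtype_le (fun i => ‖f i‖ ^ 2) S
    (fun _ => by positivity)

/-- Restriction of square-summable functions to a subset. -/
noncomputable def restrict (S : Set ι) : Ell2 ι →L[ℂ] Ell2 S :=
  (restrictₗ S).mkContinuous 1 (norm_restrictₗ_le S)

@[simp]
theorem restrict_apply (S : Set ι) (f : Ell2 ι) (v : S) : restrict S f v = f v := rfl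

theorem norm_sq_restrict_add_compl (S : Set ι) (f : Ell2 ι) :
    ‖restrict S f‖ ^ 2 + ‖restrict Sᶜ f‖ ^ 2 = ‖f‖ ^ 2 := by
  have h := (hasSum_norm_sq f).summable
  rw [← (hasSum_norm_sq (restrict S f)).tsum_eq, ← (hasSum_norm_sq (restrict Sᶜ f)).tsum_eq,
    ← (hasSum_norm_sq f).tsum_eq]
  exact (h.subtype S).tsum_add_tsum_compl (h.subtype Sᶜ)

open Classical in
theorem adjoint_restrict_single (S : Set ι) (v : S) (c : ℂ) :
    (restrict S).adjoint (lp.single 2 v c) = lp.single 2 (v : ι) c := by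
  refine ext_inner_right ℂ fun f => ?_
  rw [ContinuousLinearMap.adjoint_inner_left, lp.inner_single_left, lp.inner_single_left,
    restrict_apply]

end Ell2

namespace WeightedGraph

variable {V : Type*} (G : WeightedGraph V)

/-! ### Finiteness of the degrees -/

/-- A function in the domain of the Laplacian vanishes at every vertex of infinite degree, because
it tends to `0` along the neighbours. -/
theorem summable_weight_of_apply_ne_zero {f : Ell2 V} (hf : f ∈ G.laplacian.domain) {v : V}
    (hv : f v ≠ 0) : Summable fun u => G.w v u := by
  have h0 : Filter.Tendsto (fun u => ‖f u‖ ^ 2) Filter.cofinite (nhds 0) :=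
    (Ell2.hasSum_norm_sq f).summable.tendsto_cofinite_zero
  have hpos : 0 < ‖f v‖ := norm_pos_iff.2 hv
  have hev : ∀ᶠ u in Filter.cofinite, ‖f u‖ ^ 2 < (‖f v‖ / 2) ^ 2 :=
    h0.eventually_lt_const (by positivity)
  refine Summable.of_norm_bounded_eventually ((hf.1 v).norm.mul_left (2 / ‖f v‖)) ?_
  filter_upwards [hev] with u hu
  have h1 : ‖f u‖ < ‖f v‖ / 2 := lt_of_pow_lt_pow_left₀ 2 (by positivity) hu
  have h2 : ‖f v‖ / 2 ≤ ‖f v - f u‖ := by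
    have := norm_sub_norm_le (f v) (f u)
    linarith
  have h3 := G.nonneg v u
  rw [norm_mul, Complex.norm_real, Real.norm_of_nonneg h3, ← mul_assoc]
  refine le_mul_of_one_le_left h3 ?_
  rw [div_mul_eq_mul_div, one_le_div hpos]
  linarith

variable {G}

theorem summable_weight_of_dense (hd : Dense (G.laplacian.domain : Set (Ell2 V))) (v : V) :
    Summable fun u => G.w v u := by
  classical
  obtain ⟨f, hf, hlt⟩ := hd.exists_dist_lt (lp.single 2 v (1 : ℂ) : Ell2 V) one_pos
  refine G.summable_weight_of_apply_ne_zero hf fun h0 => ?_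
  have h1 := lp.norm_apply_le_norm (by simp) ((lp.single 2 v (1 : ℂ) : Ell2 V) - f) v
  rw [dist_eq_norm] at hlt
  simp [h0] at h1
  linarith

theorem weightTo_ne_top (hd : Dense (G.laplacian.domain : Set (Ell2 V))) (A : Set V) (v : V) :
    G.weightTo A v ≠ ∞ := by
  have h := (summable_weight_of_dense hd v).comp_injective
    (Subtype.val_injective : Function.Injective ((↑) : A → V))
  have h' : Summable fun u : A => G.w u v := h.congr fun u => G.symm v u
  rw [weightTo, ← ENNReal.ofReal_tsum_of_nonneg (fun _ => G.nonneg _ _) h']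
  exact ENNReal.ofReal_ne_top

/-! ### Green's formula on the maximal domain -/

variable (G)

/-- The normalisation `√(w(x, y) / 2)` of the gradient for which its squared norm, summed over
ordered pairs, is the energy. -/
noncomputable def gradCoeff (x : V × V) : ℂ := (√(G.w x.1 x.2 / 2) : ℝ)

theorem gradCoeff_mul_self (x : V × V) : G.gradCoeff x * G.gradCoeff x = (G.w x.1 x.2 : ℂ) / 2 := by
  have h : (0 : ℝ) ≤ G.w x.1 x.2 / 2 := by have := G.nonneg x.1 x.2; positivity
  rw [gradCoeff, ← Complex.ofReal_mul, Real.mul_self_sqrt h]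
  push_cast
  rfl

theorem norm_gradCoeff_sq (x : V × V) : ‖G.gradCoeff x‖ ^ 2 = G.w x.1 x.2 / 2 := by
  have h : (0 : ℝ) ≤ G.w x.1 x.2 / 2 := by have := G.nonneg x.1 x.2; positivity
  rw [gradCoeff, Complex.norm_real, Real.norm_eq_abs, sq_abs, Real.sq_sqrt h]

/-- `F` is the gradient of `f`: it lies in `ℓ²(V × V)` and `F(x, y) = √(w(x, y)/2) (f(x) - f(y))`.
The functions `f` that have such an `F` form the domain of the energy form, and the energy of `f`
is `‖F‖²`. -/
def IsGradient (f : Ell2 V) (F : Ell2 (V × V)) : Prop :=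
  ∀ x, F x = G.gradCoeff x * (f x.1 - f x.2)

/-- The graph of the gradient, a subspace of the Hilbert sum `ℓ²(V) ⊕ ℓ²(V × V)`. -/
def gradientGraph : Submodule ℂ (WithLp 2 (Ell2 V × Ell2 (V × V))) where
  carrier := {p | G.IsGradient p.fst p.snd}
  zero_mem' := fun x => by simp
  add_mem' := by
    intro p q hp hq x
    simp only [WithLp.add_snd, WithLp.add_fst, lp.coeFn_add, Pi.add_apply, hp x, hq x]
    ring
  smul_mem' := by
    intro c p hp x
    simp only [WithLp.smul_snd, WithLp.smul_fst, lp.coeFn_smul, Pi.smul_apply, hp x, smul_eq_mul]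
    ring

theorem isClosed_gradientGraph :
    IsClosed (G.gradientGraph : Set (WithLp 2 (Ell2 V × Ell2 (V × V)))) := by
  have e : (G.gradientGraph : Set (WithLp 2 (Ell2 V × Ell2 (V × V)))) =
      ⋂ x, {p | p.snd x = G.gradCoeff x * (p.fst x.1 - p.fst x.2)} := by
    ext p
    simp only [Set.mem_iInter]
    rfl
  rw [e]
  have h1 : ∀ x, Continuous fun p : WithLp 2 (Ell2 V × Ell2 (V × V)) => p.snd x := fun x =>
    (lp.evalCLM ℂ (fun _ : V × V => ℂ) 2 x).continuous.comp (WithLp.prod_continuous_ofLp _ _ _).snd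
  have h2 : ∀ y, Continuous fun p : WithLp 2 (Ell2 V × Ell2 (V × V)) => p.fst y := fun y =>
    (lp.evalCLM ℂ (fun _ : V => ℂ) 2 y).continuous.comp (WithLp.prod_continuous_ofLp _ _ _).fst
  exact isClosed_iInter fun x => isClosed_eq (h1 x)
    (continuous_const.mul ((h2 x.1).sub (h2 x.2)))

/-- The weak form of `(L + 1) f = h`: project `(h, 0)` orthogonally onto the graph of the
gradient. -/
theorem exists_weak_solution (h : Ell2 V) :
    ∃ f F, G.IsGradient f F ∧ ∀ g H, G.IsGradient g H → ⟪g, h - f⟫_ℂ = ⟪H, F⟫_ℂ := by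
  have : CompleteSpace G.gradientGraph := G.isClosed_gradientGraph.completeSpace_coe
  set p := G.gradientGraph.starProjection (WithLp.toLp 2 (h, 0)) with hp
  have hmem : p ∈ G.gradientGraph := Submodule.starProjection_apply_mem _ _
  refine ⟨p.fst, p.snd, hmem, fun g H hgH => ?_⟩
  have h1 := G.gradientGraph.sub_starProjection_mem_orthogonal (WithLp.toLp 2 (h, 0))
  have h2 := (Submodule.mem_orthogonal _ _).1 h1 (WithLp.toLp 2 (g, H)) hgH
  rw [← hp, WithLp.prod_inner_apply] at h2
  have h3 : ⟪g, h - p.fst⟫_ℂ + ⟪H, 0 - p.snd⟫_ℂ = 0 := h2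
  rw [zero_sub, inner_neg_right] at h3
  linear_combination h3

variable {G}

open Classical in
/-- Dirac functions have finite energy if the degrees are finite, and pairing their gradient with
that of `f` gives the Laplacian of `f`. -/
theorem exists_isGradient_single (hw : ∀ v, Summable fun u => G.w v u) (v : V) :
    ∃ H, G.IsGradient (lp.single 2 v 1) H ∧
      ∀ f F, G.IsGradient f F →
        (Summable fun u => (f v - f u) * (G.w v u : ℂ)) ∧ ⟪H, F⟫_ℂ = G.laplacianFun f v := by
  have hi₁ : Function.Injective fun u : V => (v, u) := fun a b h => (Prod.ext_iff.1 h).2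
  have hi₂ : Function.Injective fun u : V => (u, v) := fun a b h => (Prod.ext_iff.1 h).1
  -- the gradient of the Dirac function is split into the edges that leave `v` and those that enter
  let c₁ : V × V → ℂ := fun x => if x.1 = v then G.gradCoeff x else 0
  let c₂ : V × V → ℂ := fun x => if x.2 = v then G.gradCoeff x else 0
  have hs₁ : ∀ x ∉ Set.range (fun u : V => (v, u)), c₁ x = 0 := fun x hx =>
    if_neg fun h => hx ⟨x.2, Prod.ext h.symm rfl⟩
  have hs₂ : ∀ x ∉ Set.range (fun u : V => (u, v)), c₂ x = 0 := fun x hx =>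
    if_neg fun h => hx ⟨x.1, Prod.ext rfl h.symm⟩
  have hm₁ : Memℓp c₁ 2 := by
    rw [Ell2.memℓp_iff_summable, ← hi₁.summable_iff fun x hx => by simp [hs₁ x hx]]
    refine ((hw v).div_const 2).congr fun u => ?_
    simp [c₁, norm_gradCoeff_sq]
  have hm₂ : Memℓp c₂ 2 := by
    rw [Ell2.memℓp_iff_summable, ← hi₂.summable_iff fun x hx => by simp [hs₂ x hx]]
    refine ((hw v).div_const 2).congr fun u => ?_
    simp [c₂, norm_gradCoeff_sq, G.symm u v]
  let C₁ : Ell2 (V × V) := ⟨c₁, hm₁⟩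
  let C₂ : Ell2 (V × V) := ⟨c₂, hm₂⟩
  have hconj : ∀ x, (starRingEnd ℂ) (G.gradCoeff x) = G.gradCoeff x := fun x =>
    Complex.conj_ofReal _
  refine ⟨C₁ - C₂, fun x => ?_, fun f F hF => ?_⟩
  · change c₁ x - c₂ x = _
    simp only [c₁, c₂, lp.single_apply, Pi.single_apply]
    split_ifs <;> simp
  · have h₁ : HasSum (fun u => (f v - f u) * (G.w v u : ℂ) / 2) ⟪C₁, F⟫_ℂ := by
      have h := lp.hasSum_inner (𝕜 := ℂ) C₁ F
      rw [← hi₁.hasSum_iff fun x hx => by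
        change ⟪c₁ x, F x⟫_ℂ = 0
        rw [hs₁ x hx, inner_zero_left]] at h
      refine h.congr_fun fun u => ?_
      have e := G.gradCoeff_mul_self (v, u)
      change _ = ⟪c₁ (v, u), F (v, u)⟫_ℂ
      simp only [c₁, hF (v, u), if_true, RCLike.inner_apply, hconj]
      linear_combination (-(f v - f u)) * e
    have h₂ : HasSum (fun u => -((f v - f u) * (G.w v u : ℂ) / 2)) ⟪C₂, F⟫_ℂ := by
      have h := lp.hasSum_inner (𝕜 := ℂ) C₂ F
      rw [← hi₂.hasSum_iff fun x hx => by
        change ⟪c₂ x, F x⟫_ℂ = 0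
        rw [hs₂ x hx, inner_zero_left]] at h
      refine h.congr_fun fun u => ?_
      have e := G.gradCoeff_mul_self (u, v)
      rw [G.symm u v] at e
      change _ = ⟪c₂ (u, v), F (u, v)⟫_ℂ
      simp only [c₂, hF (u, v), if_true, RCLike.inner_apply, hconj]
      linear_combination (f v - f u) * e
    have h : HasSum (fun u => (f v - f u) * (G.w v u : ℂ)) (⟪C₁, F⟫_ℂ - ⟪C₂, F⟫_ℂ) :=
      (h₁.sub h₂).congr_fun fun u => by ring
    exact ⟨h.summable, by rw [inner_sub_left, laplacianFun, h.tsum_eq]⟩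

/-- The equation `(L + 1) f = h` is solvable with `f` of finite energy, and Green's formula holds
for the solution. -/
theorem exists_laplacian_add_eq (hw : ∀ v, Summable fun u => G.w v u) (h : Ell2 V) :
    ∃ f : G.laplacian.domain, G.laplacian f + f = h ∧
      ∃ F, G.IsGradient f F ∧ ⟪(f : Ell2 V), G.laplacian f⟫_ℂ = ⟪F, F⟫_ℂ := by
  classical
  obtain ⟨f, F, hF, hweak⟩ := G.exists_weak_solution h
  have hpt : ∀ v, G.laplacianFun f v = (h - f : Ell2 V) v := fun v => by
    obtain ⟨H, hH, hpair⟩ := exists_isGradient_single hw v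
    have e := hweak _ _ hH
    rw [(hpair f F hF).2, lp.inner_single_left] at e
    simpa using e.symm
  have hmem : f ∈ G.laplacian.domain := by
    refine ⟨fun v => ?_, ?_⟩
    · obtain ⟨H, hH, hpair⟩ := exists_isGradient_single hw v
      exact (hpair f F hF).1
    · rw [show G.laplacianFun f = (h - f : Ell2 V) from funext hpt]
      exact lp.memℓp _
  have hL : G.laplacian ⟨f, hmem⟩ = h - f := lp.ext (funext hpt)
  refine ⟨⟨f, hmem⟩, ?_, F, hF, ?_⟩
  · rw [hL]
    exact sub_add_cancel h f
  · rw [hL]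
    exact hweak f F hF

/-- **Green's formula.** If the Laplacian is self-adjoint on its maximal domain, then every function
of its domain has finite energy, and the energy is the quadratic form of the Laplacian. -/
theorem exists_isGradient_norm_sq_eq (hL : IsSelfAdjoint G.laplacian) (f : G.laplacian.domain) :
    ∃ F, G.IsGradient f F ∧ ⟪(f : Ell2 V), G.laplacian f⟫_ℂ = ⟪F, F⟫_ℂ := by
  have hd := hL.dense_domain
  have hw := summable_weight_of_dense hd
  have hsymm : ∀ x y : G.laplacian.domain,
      ⟪G.laplacian x, (y : Ell2 V)⟫_ℂ = ⟪(x : Ell2 V), G.laplacian y⟫_ℂ := by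
    have h := LinearPMap.adjoint_isFormalAdjoint hd
    rw [LinearPMap.isSelfAdjoint_def.1 hL] at h
    exact fun x y => h x y
  obtain ⟨g, hg, F, hF, hgF⟩ := exists_laplacian_add_eq hw (G.laplacian f + f)
  -- `L + 1` is symmetric and surjective, hence injective, so that `g = f`
  have hker : G.laplacian (f - g) + (f - g : G.laplacian.domain) = 0 := by
    rw [LinearPMap.map_sub, Submodule.coe_sub]
    rw [sub_add_sub_comm, hg, sub_self]
  obtain ⟨k, hk, -⟩ := exists_laplacian_add_eq hw ((f - g : G.laplacian.domain) : Ell2 V)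
  have hzero : ((f - g : G.laplacian.domain) : Ell2 V) = 0 := by
    rw [← inner_self_eq_zero (𝕜 := ℂ)]
    conv_lhs => arg 2; rw [← hk]
    rw [inner_add_left, hsymm, ← inner_add_right, hker, inner_zero_right]
  have hfg : f = g := sub_eq_zero.1 (Subtype.ext hzero)
  subst hfg
  exact ⟨F, hF, hgF⟩

end WeightedGraph

/-! ### Quadratic form bounds on spectral subspaces -/

section Spectral

variable {H : Type*} [NormedAddCommGroup H] [InnerProductSpace ℂ H] [CompleteSpace H]

theorem ProjectionValuedMeasure.scalarMeasure_apply (E : ProjectionValuedMeasure H) (x : H)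
    {s : Set ℝ} (hs : MeasurableSet s) :
    E.scalarMeasure x s = ENNReal.ofReal (‖E.proj s x‖ ^ 2) :=
  MeasureTheory.Measure.ofMeasurable_apply s hs

theorem ProjectionValuedMeasure.scalarMeasure_univ (E : ProjectionValuedMeasure H) (x : H) :
    E.scalarMeasure x Set.univ = ENNReal.ofReal (‖x‖ ^ 2) := by
  rw [E.scalarMeasure_apply x MeasurableSet.univ, E.univ', one_apply_eq_self]

theorem ProjectionValuedMeasure.ae_mem_of_proj_apply_eq (E : ProjectionValuedMeasure H) {x : H}
    {s : Set ℝ} (hs : MeasurableSet s) (hx : E.proj s x = x) : ∀ᵐ t ∂E.scalarMeasure x, t ∈ s := by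
  rw [MeasureTheory.ae_iff]
  change E.scalarMeasure x sᶜ = 0
  have h : E.proj sᶜ x = 0 := by
    conv_lhs => rw [← hx]
    rw [← mul_apply_eq_comp, ← E.inter' _ _ hs.compl hs, Set.compl_inter_self, E.empty',
      zero_apply]
  rw [E.scalarMeasure_apply x hs.compl, h]
  simp

/-- A vector in the range of `1_{[0, ω]}(T)` lies in the domain of `T`, and the quadratic form of
`T` at this vector is at most `ω` times the squared norm. -/
theorem mem_domain_and_norm_inner_le {T : H →ₗ.[ℂ] H} {ω : ℝ} {x : H}
    (hx : spectralProjection T (Set.Icc 0 ω) x = x) :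
    ∃ h : x ∈ T.domain, ‖⟪x, T ⟨x, h⟩⟫_ℂ‖ ≤ ω * ‖x‖ ^ 2 := by
  unfold spectralProjection at hx
  split_ifs at hx with hE
  · obtain ⟨hdom, hform⟩ := hE.choose_spec
    set E := hE.choose
    have hae := E.ae_mem_of_proj_apply_eq measurableSet_Icc hx
    have huniv := E.scalarMeasure_univ x
    have hmem : x ∈ T.domain := by
      rw [hdom x]
      calc ∫⁻ t, ENNReal.ofReal (t ^ 2) ∂E.scalarMeasure x
          ≤ ∫⁻ _, ENNReal.ofReal (ω ^ 2) ∂E.scalarMeasure x := by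
            refine MeasureTheory.lintegral_mono_ae ?_
            filter_upwards [hae] with t ht
            exact ENNReal.ofReal_le_ofReal (pow_le_pow_left₀ ht.1 ht.2 2)
        _ < ∞ := by
            rw [MeasureTheory.lintegral_const, huniv]
            exact ENNReal.mul_lt_top ENNReal.ofReal_lt_top ENNReal.ofReal_lt_top
    refine ⟨hmem, ?_⟩
    have : MeasureTheory.IsFiniteMeasure (E.scalarMeasure x) :=
      ⟨by rw [huniv]; exact ENNReal.ofReal_lt_top⟩
    rw [hform ⟨x, hmem⟩]
    refine (MeasureTheory.norm_integral_le_of_norm_le_const (C := ω) ?_).trans_eq ?_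
    · filter_upwards [hae] with t ht
      rw [Complex.norm_real, Real.norm_of_nonneg ht.1]
      exact ht.2
    · rw [MeasureTheory.measureReal_def, huniv, ENNReal.toReal_ofReal (by positivity)]
  · -- without a spectral measure the projection is `0` by convention
    have hx0 : x = 0 := hx.symm
    subst hx0
    exact ⟨T.domain.zero_mem, by simp⟩

end Spectral

/-! ### The inequality across the cut -/

namespace WeightedGraph

variable {V : Type*} (G : WeightedGraph V)

theorem enorm_gradCoeff_sq (u v : V) :
    ‖G.gradCoeff (u, v)‖ₑ ^ 2 = ENNReal.ofReal (G.w u v) * 2⁻¹ := by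
  rw [← ofReal_norm, ← ENNReal.ofReal_pow (norm_nonneg _), norm_gradCoeff_sq,
    ENNReal.ofReal_div_of_pos two_pos, ENNReal.ofReal_ofNat, div_eq_mul_inv]

theorem tsum_enorm_gradCoeff_mul_sq (f : V → ℂ) (T S : Set V) :
    ∑' x : T × S, ‖G.gradCoeff (x.1, x.2) * f x.1‖ₑ ^ 2 =
      (∑' v : T, G.weightTo S v * ‖f v‖ₑ ^ 2) * 2⁻¹ := by
  rw [← ENNReal.tsum_mul_right, ENNReal.tsum_prod']
  refine tsum_congr fun v => ?_
  rw [weightTo, mul_assoc, ← ENNReal.tsum_mul_right]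
  refine tsum_congr fun u => ?_
  rw [enorm_mul, mul_pow, enorm_gradCoeff_sq, G.symm v u]
  ring

theorem tsum_enorm_gradCoeff_mul_sq' (f : V → ℂ) (T S : Set V) :
    ∑' x : T × S, ‖G.gradCoeff (x.1, x.2) * f x.2‖ₑ ^ 2 =
      (∑' u : S, G.weightTo T u * ‖f u‖ₑ ^ 2) * 2⁻¹ := by
  rw [← tsum_enorm_gradCoeff_mul_sq, ← (Equiv.prodComm S T).tsum_eq]
  refine tsum_congr fun x => ?_
  simp [gradCoeff, G.symm x.2 x.1]

variable {G}

/-- On the edges between `T` and `S`, the values of `f` at the ends in `T` differ from those at the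
ends in `S` by the gradient. Minkowski's inequality in `ℓ²(T × S)`, weighted by the edges, compares
the norms of `f` on `T` and on `S`. The factor `√2` undoes the normalisation of the gradient. -/
theorem sqrt_mul_norm_restrict_le {f : Ell2 V} {F : Ell2 (V × V)} (hF : G.IsGradient f F)
    {S T : Set V} {k d : ℝ≥0∞} (hk : ∀ v ∈ T, k ≤ G.weightTo S v)
    (hd : ∀ u ∈ S, G.weightTo T u ≤ d) (hd' : d ≠ ∞) :
    √k.toReal * ‖Ell2.restrict T f‖ ≤ √d.toReal * ‖Ell2.restrict S f‖ + √2 * ‖F‖ := by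
  have hiX := G.tsum_enorm_gradCoeff_mul_sq f T S
  have hiY := G.tsum_enorm_gradCoeff_mul_sq' f T S
  have hleY : ∑' x : T × S, ‖G.gradCoeff (x.1, x.2) * f x.2‖ₑ ^ 2 ≤
      d * ENNReal.ofReal (‖Ell2.restrict S f‖ ^ 2) * 2⁻¹ := by
    rw [hiY, ← Ell2.tsum_enorm_sq, ← ENNReal.tsum_mul_left]
    gcongr with u
    · exact hd u u.2
    · exact le_rfl
  have hfinY : d * ENNReal.ofReal (‖Ell2.restrict S f‖ ^ 2) * 2⁻¹ ≠ ∞ :=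
    ENNReal.mul_ne_top (ENNReal.mul_ne_top hd' ENNReal.ofReal_ne_top) (by simp)
  let Y : Ell2 (T × S) := ⟨fun x => G.gradCoeff (x.1, x.2) * f x.2,
    Ell2.memℓp_of_tsum_ne_top (ne_top_of_le_ne_top hfinY hleY)⟩
  have hi : Function.Injective fun x : T × S => ((x.1 : V), (x.2 : V)) := fun x y h =>
    Prod.ext (Subtype.ext (Prod.ext_iff.1 h).1) (Subtype.ext (Prod.ext_iff.1 h).2)
  have hleZ : ∑' x : T × S, ‖F (x.1, x.2)‖ₑ ^ 2 ≤ ENNReal.ofReal (‖F‖ ^ 2) := by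
    rw [← Ell2.tsum_enorm_sq]
    exact ENNReal.tsum_comp_le_tsum_of_injective hi fun y => ‖F y‖ₑ ^ 2
  let Z : Ell2 (T × S) := ⟨fun x => F (x.1, x.2),
    Ell2.memℓp_of_tsum_ne_top (ne_top_of_le_ne_top ENNReal.ofReal_ne_top hleZ)⟩
  have hZ : ‖Z‖ ≤ ‖F‖ := by
    rw [← sq_le_sq₀ (norm_nonneg _) (norm_nonneg _),
      ← ENNReal.ofReal_le_ofReal_iff (by positivity), ← Ell2.tsum_enorm_sq]
    exact hleZ
  have hY : ‖Y‖ ^ 2 ≤ d.toReal * ‖Ell2.restrict S f‖ ^ 2 / 2 := by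
    have h := ENNReal.toReal_mono hfinY ((Ell2.tsum_enorm_sq Y).symm.trans_le hleY)
    rwa [ENNReal.toReal_ofReal (by positivity), ENNReal.toReal_mul, ENNReal.toReal_mul,
      ENNReal.toReal_ofReal (by positivity), ENNReal.toReal_inv, ENNReal.toReal_ofNat,
      ← div_eq_mul_inv] at h
  have hX : k.toReal * ‖Ell2.restrict T f‖ ^ 2 / 2 ≤ ‖Y + Z‖ ^ 2 := by
    have hle : k * ENNReal.ofReal (‖Ell2.restrict T f‖ ^ 2) * 2⁻¹ ≤
        ENNReal.ofReal (‖Y + Z‖ ^ 2) := by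
      have hYZ : ∀ x, (Y + Z) x = G.gradCoeff (x.1, x.2) * f x.1 := fun x => by
        change G.gradCoeff (x.1, x.2) * f x.2 + F (x.1, x.2) = _
        rw [hF]
        ring
      rw [← Ell2.tsum_enorm_sq (Y + Z), tsum_congr fun x => by rw [hYZ x], hiX,
        ← Ell2.tsum_enorm_sq, ← ENNReal.tsum_mul_left]
      gcongr with v
      · exact hk v v.2
      · exact le_rfl
    have h := ENNReal.toReal_mono ENNReal.ofReal_ne_top hle
    rwa [ENNReal.toReal_ofReal (by positivity), ENNReal.toReal_mul, ENNReal.toReal_mul,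
      ENNReal.toReal_ofReal (by positivity), ENNReal.toReal_inv, ENNReal.toReal_ofNat,
      ← div_eq_mul_inv] at h
  have h2 : √2 ^ 2 = (2 : ℝ) := Real.sq_sqrt zero_le_two
  have hX' : √k.toReal * ‖Ell2.restrict T f‖ ≤ √2 * ‖Y + Z‖ := by
    rw [← sq_le_sq₀ (by positivity) (by positivity), mul_pow, mul_pow, h2,
      Real.sq_sqrt ENNReal.toReal_nonneg]
    linarith
  have hY' : √2 * ‖Y‖ ≤ √d.toReal * ‖Ell2.restrict S f‖ := by
    rw [← sq_le_sq₀ (by positivity) (by positivity), mul_pow, mul_pow, h2,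
      Real.sq_sqrt ENNReal.toReal_nonneg]
    linarith
  calc √k.toReal * ‖Ell2.restrict T f‖ ≤ √2 * ‖Y + Z‖ := hX'
    _ ≤ √2 * (‖Y‖ + ‖Z‖) := by gcongr; exact norm_add_le Y Z
    _ = √2 * ‖Y‖ + √2 * ‖Z‖ := mul_add _ _ _
    _ ≤ √d.toReal * ‖Ell2.restrict S f‖ + √2 * ‖F‖ := by gcongr

/-- The inequality across the cut for functions of the Paley–Wiener space, whose energy is at most
`ω ‖f‖²`. -/
theorem sqrt_mul_norm_restrict_le_of_mem_paleyWiener (hL : IsSelfAdjoint G.laplacian) {ω : ℝ}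
    (hω : 0 ≤ ω) {f : Ell2 V} (hf : G.pwProjection ω f = f)
    {S T : Set V} {k d : ℝ≥0∞} (hk : ∀ v ∈ T, k ≤ G.weightTo S v)
    (hd : ∀ u ∈ S, G.weightTo T u ≤ d) (hd' : d ≠ ∞) :
    √k.toReal * ‖Ell2.restrict T f‖ ≤ √d.toReal * ‖Ell2.restrict S f‖ + √(2 * ω) * ‖f‖ := by
  obtain ⟨hmem, hle⟩ := mem_domain_and_norm_inner_le hf
  obtain ⟨F, hF, hgreen⟩ := exists_isGradient_norm_sq_eq hL ⟨f, hmem⟩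
  rw [hgreen, inner_self_eq_norm_sq_to_K, norm_pow, RCLike.norm_ofReal, abs_norm] at hle
  have hF' : √2 * ‖F‖ ≤ √(2 * ω) * ‖f‖ := by
    rw [← sq_le_sq₀ (by positivity) (by positivity), mul_pow, mul_pow, Real.sq_sqrt zero_le_two,
      Real.sq_sqrt (by positivity)]
    linarith
  have := sqrt_mul_norm_restrict_le hF hk hd hd'
  linarith

end WeightedGraph

/-! ### From the inequality across the cut to the frame bounds -/

section Arithmetic

variable {a b n k d c : ℝ}

theorem lower_frame_bound_of_cut (ha : 0 ≤ a) (hb : 0 ≤ b) (hn : 0 ≤ n) (hk : 0 < k) (hd : 0 ≤ d)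
    (hc : 0 ≤ c) (hck : c / k ≤ 1) (hab : a ^ 2 + b ^ 2 = n ^ 2)
    (hcut : √k * b ≤ √d * a + √c * n) :
    (1 - √(c / k)) ^ 2 * (1 + d / k)⁻¹ * n ^ 2 ≤ a ^ 2 := by
  have hk' : 0 < √k := Real.sqrt_pos.2 hk
  have hb' : b ≤ √(d / k) * a + √(c / k) * n := by
    rw [Real.sqrt_div hd, Real.sqrt_div hc, div_mul_eq_mul_div, div_mul_eq_mul_div, ← add_div,
      le_div_iff₀ hk']
    linarith
  set s := √(c / k)
  set r := √(d / k) with hr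
  have hs : 0 ≤ s := Real.sqrt_nonneg _
  have hs1 : s ≤ 1 := Real.sqrt_le_one.2 hck
  have hr0 : 0 ≤ r := Real.sqrt_nonneg _
  have hr2 : r ^ 2 = d / k := Real.sq_sqrt (by positivity)
  set q := √(1 + r ^ 2)
  have hq2 : q ^ 2 = 1 + r ^ 2 := Real.sq_sqrt (by positivity)
  have hq0 : 0 < q := Real.sqrt_pos.2 (by positivity)
  have hrq : r ≤ q := Real.le_sqrt_of_sq_le (by linarith)
  -- the triangle inequality in the plane for `(a, b) ≤ (a, r a) + (0, s n)`
  have htri : n ≤ q * a + s * n := by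
    rw [← sq_le_sq₀ hn (by positivity), ← hab]
    have h1 : b ^ 2 ≤ (r * a + s * n) ^ 2 := pow_le_pow_left₀ hb hb' 2
    have h2 : r * (a * (s * n)) ≤ q * (a * (s * n)) :=
      mul_le_mul_of_nonneg_right hrq (by positivity)
    have h3 : (q * a) ^ 2 = a ^ 2 + (r * a) ^ 2 := by rw [mul_pow, hq2]; ring
    linear_combination h1 + 2 * h2 - h3
  rw [← hr2, ← hq2, mul_right_comm, ← div_eq_mul_inv, div_le_iff₀ (by positivity), ← mul_pow,
    ← mul_pow]
  refine pow_le_pow_left₀ (mul_nonneg (by linarith) hn) ?_ 2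
  linarith

theorem upper_frame_bound_of_cut (ha : 0 ≤ a) (hb : 0 ≤ b) (hn : 0 ≤ n) (hk : 0 ≤ k) (hd : 0 < d)
    (hc : 0 ≤ c) (hab : a ^ 2 + b ^ 2 = n ^ 2) (hcut : √k * a ≤ √d * b + √c * n) :
    a ^ 2 ≤ (1 + √(c / d)) ^ 2 * (1 + k / d)⁻¹ * n ^ 2 := by
  have hd' : 0 < √d := Real.sqrt_pos.2 hd
  have hb' : √(k / d) * a ≤ b + √(c / d) * n := by
    rw [Real.sqrt_div hk, Real.sqrt_div hc, div_mul_eq_mul_div, div_mul_eq_mul_div,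
      div_le_iff₀ hd', add_mul, div_mul_cancel₀ _ hd'.ne']
    linarith
  set s := √(c / d)
  set r := √(k / d) with hr
  have hs : 0 ≤ s := Real.sqrt_nonneg _
  have hr0 : 0 ≤ r := Real.sqrt_nonneg _
  have hr2 : r ^ 2 = k / d := Real.sq_sqrt (by positivity)
  have hbn : b ≤ n := by
    rw [← sq_le_sq₀ hb hn]
    linarith [sq_nonneg a]
  have h1 : (r * a) ^ 2 ≤ (b + s * n) ^ 2 := pow_le_pow_left₀ (by positivity) hb' 2
  have h2 : b * (s * n) ≤ n * (s * n) := mul_le_mul_of_nonneg_right hbn (by positivity)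
  rw [← hr2, mul_right_comm, ← div_eq_mul_inv, le_div_iff₀ (by positivity)]
  linear_combination h1 + 2 * h2 + hab

end Arithmetic

/-! ### The constants of the cut -/

namespace WeightedGraph

variable {V : Type*} {G : WeightedGraph V} {S : Set V} {ω : ℝ}

theorem K_le_weightTo {v : V} (hv : v ∈ Sᶜ) : G.K S ≤ G.weightTo S v := iInf₂_le v hv

theorem weightTo_le_Dhat {v : V} (hv : v ∈ Sᶜ) : G.weightTo S v ≤ G.Dhat S :=
  le_iSup₂ (f := fun v (_ : v ∈ Sᶜ) => G.weightTo S v) v hv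

theorem Khat_le_weightTo {v : V} (hv : v ∈ S) : G.Khat S ≤ G.weightTo Sᶜ v := iInf₂_le v hv

theorem weightTo_le_D {v : V} (hv : v ∈ S) : G.weightTo Sᶜ v ≤ G.D S :=
  le_iSup₂ (f := fun v (_ : v ∈ S) => G.weightTo Sᶜ v) v hv

theorem nonempty_of_K_ne_zero (hS : Sᶜ.Nonempty) (hK : G.K S ≠ 0) : S.Nonempty := by
  obtain ⟨v, hv⟩ := hS
  by_contra h
  rw [Set.not_nonempty_iff_eq_empty] at h
  subst h
  refine hK (le_bot_iff.1 ((K_le_weightTo hv).trans_eq ?_))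
  simp [weightTo]

theorem lowerBound_eq_zero (hD : G.D S = ∞) (hK : G.K S ≠ ∞) : G.lowerBound S ω = 0 := by
  simp [lowerBound, hD, ENNReal.top_div_of_ne_top hK]

theorem lowerBound_eq (hω : 0 ≤ ω) (hD : G.D S ≠ ∞) (hK : G.K S ≠ 0) :
    G.lowerBound S ω = (1 - √(2 * ω / (G.K S).toReal)) ^ 2 *
      (1 + (G.D S).toReal / (G.K S).toReal)⁻¹ := by
  rw [lowerBound, ENNReal.toReal_div, ENNReal.toReal_ofReal (by positivity), ENNReal.toReal_inv,
    ENNReal.toReal_add ENNReal.one_ne_top (ENNReal.div_ne_top hD hK), ENNReal.toReal_div,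
    ENNReal.toReal_one]

theorem upperBound_eq_one (hD : G.Dhat S = ∞) : G.upperBound S ω = 1 := by
  simp [upperBound, hD]

theorem upperBound_eq (hω : 0 ≤ ω) (hK : G.Khat S ≠ ∞) (hD : G.Dhat S ≠ 0) :
    G.upperBound S ω = (1 + √(2 * ω / (G.Dhat S).toReal)) ^ 2 *
      (1 + (G.Khat S).toReal / (G.Dhat S).toReal)⁻¹ := by
  rw [upperBound, ENNReal.toReal_div, ENNReal.toReal_ofReal (by positivity), ENNReal.toReal_inv,
    ENNReal.toReal_add ENNReal.one_ne_top (ENNReal.div_ne_top hK hD), ENNReal.toReal_div,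
    ENNReal.toReal_one]

/-- The constants of the cut, for finite degrees and `ω < K₀ / 2`: `K₀`, `K̂₀` are finite,
`K₀`, `D̂₀` are positive, and `√(2ω/K₀) < 1`. -/
theorem cut_constants (hd : Dense (G.laplacian.domain : Set (Ell2 V))) (hS : Sᶜ.Nonempty)
    (hω : 0 ≤ ω) (hωK : ENNReal.ofReal ω < G.K S / 2) :
    G.K S ≠ 0 ∧ G.K S ≠ ∞ ∧ G.Khat S ≠ ∞ ∧ G.Dhat S ≠ 0 ∧ G.K S ≤ G.Dhat S ∧
      G.Khat S ≤ G.D S ∧ 2 * ω / (G.K S).toReal < 1 := by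
  have hK0 : G.K S ≠ 0 := by
    intro h
    rw [h, ENNReal.zero_div] at hωK
    exact not_lt_zero hωK
  obtain ⟨u, hu⟩ := nonempty_of_K_ne_zero hS hK0
  obtain ⟨v, hv⟩ := hS
  have hKt : G.K S ≠ ∞ := ne_top_of_le_ne_top (weightTo_ne_top hd S v) (K_le_weightTo hv)
  have hKh : G.Khat S ≠ ∞ := ne_top_of_le_ne_top (weightTo_ne_top hd Sᶜ u) (Khat_le_weightTo hu)
  have hKD : G.K S ≤ G.Dhat S := (K_le_weightTo hv).trans (weightTo_le_Dhat hv)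
  have hpos : 0 < (G.K S).toReal := ENNReal.toReal_pos hK0 hKt
  refine ⟨hK0, hKt, hKh, (pos_iff_ne_zero.2 hK0 |>.trans_le hKD).ne', hKD,
    (Khat_le_weightTo hu).trans (weightTo_le_D hu), ?_⟩
  have h := (ENNReal.ofReal_lt_iff_lt_toReal hω (ENNReal.div_ne_top hKt two_ne_zero)).1 hωK
  rw [ENNReal.toReal_div, ENNReal.toReal_ofNat] at h
  rw [div_lt_one hpos]
  linarith

theorem lowerBound_nonneg : 0 ≤ G.lowerBound S ω :=
  mul_nonneg (sq_nonneg _) ENNReal.toReal_nonneg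

theorem lowerBound_pos (hω : 0 ≤ ω) (hK0 : G.K S ≠ 0) (hK1 : 2 * ω / (G.K S).toReal < 1)
    (hD : G.D S ≠ ∞) : 0 < G.lowerBound S ω := by
  rw [lowerBound_eq hω hD hK0]
  have h1 : √(2 * ω / (G.K S).toReal) < 1 :=
    (Real.sqrt_lt' one_pos).2 (by rwa [one_pow])
  have h2 : 0 < 1 - √(2 * ω / (G.K S).toReal) := by linarith
  positivity

theorem upperBound_pos (hKh : G.Khat S ≠ ∞) (hDh : G.Dhat S ≠ 0) : 0 < G.upperBound S ω := by
  refine mul_pos (by positivity) (ENNReal.toReal_pos ?_ ?_)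
  · exact ENNReal.inv_ne_zero.2 (ENNReal.add_ne_top.2
      ⟨ENNReal.one_ne_top, ENNReal.div_ne_top hKh hDh⟩)
  · exact ENNReal.inv_ne_top.2 (by simp)

/-- `A ≤ B` holds even when the Paley–Wiener space is trivial: `K₀ ≤ D̂₀` and `K̂₀ ≤ D₀` give
`A ≤ 1 / (1 + D₀/K₀) ≤ 1 / (1 + K̂₀/D̂₀) ≤ B`. -/
theorem lowerBound_le_upperBound (hω : 0 ≤ ω)
    (hK1 : 2 * ω / (G.K S).toReal < 1) (hKD : G.K S ≤ G.Dhat S) (hKD' : G.Khat S ≤ G.D S) :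
    G.lowerBound S ω ≤ G.upperBound S ω := by
  have hs : √((ENNReal.ofReal (2 * ω) / G.K S).toReal) ≤ 1 := by
    rw [ENNReal.toReal_div, ENNReal.toReal_ofReal (by positivity)]
    exact Real.sqrt_le_one.2 hK1.le
  have hs0 := Real.sqrt_nonneg (ENNReal.ofReal (2 * ω) / G.K S).toReal
  have ht0 := Real.sqrt_nonneg (ENNReal.ofReal (2 * ω) / G.Dhat S).toReal
  refine mul_le_mul ?_ ?_ ENNReal.toReal_nonneg (sq_nonneg _)
  · exact pow_le_pow_left₀ (by linarith) (by linarith) 2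
  · refine ENNReal.toReal_mono (ENNReal.inv_ne_top.2 (by simp)) (ENNReal.inv_le_inv.2 ?_)
    gcongr

/-! ### The frame inequality -/

theorem pwProjection_apply_of_mem {f : Ell2 V} (hf : f ∈ G.paleyWiener ω) :
    G.pwProjection ω f = f := by
  obtain ⟨g, rfl⟩ := hf
  have h := (isStarProjection_spectralProjection G.laplacian
    (measurableSet_Icc (a := 0) (b := ω))).isIdempotentElem
  exact congrArg (fun T : Ell2 V →L[ℂ] Ell2 V => T g) h

theorem inner_theta {f : Ell2 V} (hf : f ∈ G.paleyWiener ω) (v : V) :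
    ⟪G.theta ω v, f⟫_ℂ = f v := by
  classical
  have h := (isStarProjection_spectralProjection G.laplacian
    (measurableSet_Icc (a := 0) (b := ω))).isSelfAdjoint.star_eq
  have h2 := ContinuousLinearMap.adjoint_inner_left (G.pwProjection ω) f (lp.single 2 v (1 : ℂ))
  rw [← ContinuousLinearMap.star_eq_adjoint, pwProjection, h] at h2
  rw [theta, pwProjection, h2, ← pwProjection, pwProjection_apply_of_mem hf,
    lp.inner_single_left]
  simp

theorem frame_bounds (hL : IsSelfAdjoint G.laplacian) (hS : Sᶜ.Nonempty) (hω : 0 ≤ ω)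
    (hωK : ENNReal.ofReal ω < G.K S / 2) {f : Ell2 V} (hf : G.pwProjection ω f = f) :
    G.lowerBound S ω * ‖f‖ ^ 2 ≤ ‖Ell2.restrict S f‖ ^ 2 ∧
      ‖Ell2.restrict S f‖ ^ 2 ≤ G.upperBound S ω * ‖f‖ ^ 2 := by
  obtain ⟨hK0, hKt, hKh, hDh, -, -, hK1⟩ := cut_constants hL.dense_domain hS hω hωK
  have hsum := Ell2.norm_sq_restrict_add_compl S f
  constructor
  · by_cases hD : G.D S = ∞
    · rw [lowerBound_eq_zero hD hKt, zero_mul]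
      positivity
    · rw [lowerBound_eq hω hD hK0]
      exact lower_frame_bound_of_cut (norm_nonneg _) (norm_nonneg _) (norm_nonneg _)
        (ENNReal.toReal_pos hK0 hKt) ENNReal.toReal_nonneg (by positivity) hK1.le hsum
        (sqrt_mul_norm_restrict_le_of_mem_paleyWiener hL hω hf (fun _ => K_le_weightTo)
          (fun _ => weightTo_le_D) hD)
  · by_cases hD : G.Dhat S = ∞
    · rw [upperBound_eq_one hD, one_mul, ← hsum]
      exact le_add_of_nonneg_right (by positivity)
    · rw [upperBound_eq hω hKh hDh]
      exact upper_frame_bound_of_cut (norm_nonneg _) (norm_nonneg _) (norm_nonneg _)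
        ENNReal.toReal_nonneg (ENNReal.toReal_pos hDh hD) (by positivity) hsum
        (sqrt_mul_norm_restrict_le_of_mem_paleyWiener hL hω hf (fun _ => Khat_le_weightTo)
          (fun _ => weightTo_le_Dhat) hD)

end WeightedGraph

/-! ### The frame algorithm -/

/-- The relaxed frame operator `1 - τ P R†R` on the range of the projection `P`: its norm is the
supremum of its Rayleigh quotients, which the frame bounds `A` and `B` of `R` control. -/
theorem norm_sub_smul_le_of_frame_bounds {H K : Type*} [NormedAddCommGroup H]
    [InnerProductSpace ℂ H] [CompleteSpace H] [NormedAddCommGroup K] [InnerProductSpace ℂ K]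
    [CompleteSpace K] {P : H →L[ℂ] H} (hP : IsStarProjection P) (R : H →L[ℂ] K) {A B τ : ℝ}
    (hτ : 0 ≤ τ) (hA : ∀ f, P f = f → A * ‖f‖ ^ 2 ≤ ‖R f‖ ^ 2)
    (hB : ∀ f, P f = f → ‖R f‖ ^ 2 ≤ B * ‖f‖ ^ 2) {f : H} (hf : P f = f) :
    ‖f - (τ : ℂ) • P (R.adjoint (R f))‖ ≤ max |1 - τ * A| |1 - τ * B| * ‖f‖ := by
  have hPP : ∀ x, P (P x) = P x := fun x =>
    congrArg (fun T : H →L[ℂ] H => T x) hP.isIdempotentElem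
  have hPs : ∀ x y, ⟪P x, y⟫_ℂ = ⟪x, P y⟫_ℂ := fun x y => by
    have h := ContinuousLinearMap.adjoint_inner_left P y x
    rwa [← ContinuousLinearMap.star_eq_adjoint, hP.isSelfAdjoint.star_eq] at h
  have hPle : ∀ x, ‖P x‖ ≤ ‖x‖ := fun x =>
    (P.le_of_opNorm_le (IsStarProjection.norm_le P hP) x).trans_eq (one_mul _)
  set c := max |1 - τ * A| |1 - τ * B|
  have hc : 0 ≤ c := (abs_nonneg _).trans (le_max_left _ _)
  let Q : H →L[ℂ] H := P ∘L (1 - (τ : ℂ) • (R.adjoint ∘L R)) ∘L P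
  have hQ : ∀ x, Q x = P (P x - (τ : ℂ) • R.adjoint (R (P x))) := fun _ => rfl
  have hQin : ∀ x y, ⟪Q x, y⟫_ℂ = ⟪P x, P y⟫_ℂ - τ * ⟪R (P x), R (P y)⟫_ℂ := fun x y => by
    rw [hQ, hPs, inner_sub_left, inner_smul_left, ContinuousLinearMap.adjoint_inner_left,
      Complex.conj_ofReal]
  have hsymm : (Q : H →ₗ[ℂ] H).IsSymmetric := fun x y => by
    change ⟪Q x, y⟫_ℂ = ⟪x, Q y⟫_ℂ
    rw [← inner_conj_symm x, hQin, hQin, map_sub, map_mul, inner_conj_symm, inner_conj_symm,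
      Complex.conj_ofReal]
  have hnorm : ‖Q‖ ≤ c := by
    rw [Q.norm_eq_iSup_rayleighQuotient hsymm]
    refine ciSup_le fun x => ?_
    have hform : Q.reApplyInnerSelf x = ‖P x‖ ^ 2 - τ * ‖R (P x)‖ ^ 2 := by
      rw [ContinuousLinearMap.reApplyInnerSelf_apply, hQin, inner_self_eq_norm_sq_to_K,
        inner_self_eq_norm_sq_to_K]
      change ((‖P x‖ : ℂ) ^ 2 - τ * (‖R (P x)‖ : ℂ) ^ 2).re = _
      norm_cast
    rw [ContinuousLinearMap.rayleighQuotient, hform, abs_div, abs_of_nonneg (sq_nonneg ‖x‖)]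
    refine div_le_of_le_mul₀ (sq_nonneg _) hc ?_
    have hPx : ‖P x‖ ^ 2 ≤ ‖x‖ ^ 2 := pow_le_pow_left₀ (norm_nonneg _) (hPle x) 2
    have h1 := mul_le_mul_of_nonneg_left (hA _ (hPP x)) hτ
    have h2 := mul_le_mul_of_nonneg_left (hB _ (hPP x)) hτ
    calc |‖P x‖ ^ 2 - τ * ‖R (P x)‖ ^ 2|
        ≤ max |(1 - τ * B) * ‖P x‖ ^ 2| |(1 - τ * A) * ‖P x‖ ^ 2| :=
          abs_le_max_abs_abs (by linarith) (by linarith)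
      _ = c * ‖P x‖ ^ 2 := by
          rw [abs_mul, abs_mul, abs_of_nonneg (sq_nonneg ‖P x‖),
            ← max_mul_of_nonneg _ _ (sq_nonneg ‖P x‖), max_comm]
      _ ≤ c * ‖x‖ ^ 2 := by gcongr
  have hQf : Q f = f - (τ : ℂ) • P (R.adjoint (R f)) := by
    rw [hQ, hf, map_sub, map_smul, hf]
  rw [← hQf]
  exact Q.le_of_opNorm_le hnorm f

namespace WeightedGraph

variable {V : Type*} {G : WeightedGraph V} {S : Set V} {ω : ℝ}

variable (G S ω) in
/-- The frame series is the projection onto the Paley–Wiener space of the function that equals `f`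
on `S` and `0` elsewhere. -/
theorem hasSum_frame (f : Ell2 V) :
    HasSum (fun v : S => f v • G.theta ω v)
      (G.pwProjection ω ((Ell2.restrict S).adjoint (Ell2.restrict S f))) := by
  classical
  have h := ((lp.hasSum_single (p := 2) (by simp) (Ell2.restrict S f)).mapL
    (Ell2.restrict S).adjoint).mapL (G.pwProjection ω)
  refine h.congr_fun fun v => ?_
  rw [Ell2.adjoint_restrict_single, theta, ← map_smul, ← lp.single_smul, smul_eq_mul, mul_one,
    Ell2.restrict_apply]

theorem frameIterate_mem_paleyWiener (τ : ℝ) (f : Ell2 V) (n : ℕ) :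
    G.frameIterate ω S τ f n ∈ G.paleyWiener ω := by
  induction n with
  | zero => exact Submodule.zero_mem _
  | succ n ih =>
    rw [frameIterate, (hasSum_frame G S ω _).tsum_eq]
    exact Submodule.add_mem _ ih (Submodule.smul_mem _ _ ⟨_, rfl⟩)

theorem norm_sub_frameIterate_le (hL : IsSelfAdjoint G.laplacian) (hS : Sᶜ.Nonempty) (hω : 0 ≤ ω)
    (hωK : ENNReal.ofReal ω < G.K S / 2) {τ : ℝ} (hτ : 0 ≤ τ) {f : Ell2 V}
    (hf : f ∈ G.paleyWiener ω) (n : ℕ) :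
    ‖f - G.frameIterate ω S τ f n‖ ≤
      max |1 - τ * G.lowerBound S ω| |1 - τ * G.upperBound S ω| ^ n * ‖f‖ := by
  induction n with
  | zero => simp [frameIterate]
  | succ n ih =>
    have hmem := pwProjection_apply_of_mem
      (Submodule.sub_mem _ hf (frameIterate_mem_paleyWiener (S := S) τ f n))
    have hstep := norm_sub_smul_le_of_frame_bounds
      (isStarProjection_spectralProjection G.laplacian (measurableSet_Icc (a := 0) (b := ω)))
      (Ell2.restrict S) hτ (fun g hg => (frame_bounds hL hS hω hωK hg).1)
      (fun g hg => (frame_bounds hL hS hω hωK hg).2) hmem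
    rw [frameIterate, (hasSum_frame G S ω _).tsum_eq, ← sub_sub, pow_succ', mul_assoc]
    exact hstep.trans (mul_le_mul_of_nonneg_left ih ((abs_nonneg _).trans (le_max_left _ _)))

end WeightedGraph

theorem mainTheorem11 {V : Type*} (G : WeightedGraph V)
    (hL : IsSelfAdjoint G.laplacian)
    (S₀ : Set V) (hS₁ : S₀ᶜ.Nonempty)
    (ω : ℝ) (hω : 0 ≤ ω) (hωK : ENNReal.ofReal ω < G.K S₀ / 2) :
    -- the bounds satisfy `0 ≤ A ≤ B`, `0 < B`, and `0 < A` as soon as `D₀` is finite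
    (0 ≤ G.lowerBound S₀ ω ∧ G.lowerBound S₀ ω ≤ G.upperBound S₀ ω ∧ 0 < G.upperBound S₀ ω ∧
      (G.D S₀ < ∞ → 0 < G.lowerBound S₀ ω)) ∧
    -- `S₀` is a sampling set: frame inequality for the `θ_v`, `v ∈ S₀`, in `PW_ω(L_w)`
    (∀ v : S₀, G.theta ω v ∈ G.paleyWiener ω) ∧
    (∀ f ∈ G.paleyWiener ω,
      (∀ v : S₀, inner ℂ (G.theta ω v) f = f v) ∧
      Summable (fun v : S₀ => ‖f v‖ ^ 2) ∧
      G.lowerBound S₀ ω * ‖f‖ ^ 2 ≤ ∑' v : S₀, ‖inner ℂ (G.theta ω v) f‖ ^ 2 ∧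
      ∑' v : S₀, ‖inner ℂ (G.theta ω v) f‖ ^ 2 ≤ G.upperBound S₀ ω * ‖f‖ ^ 2) ∧
    -- the frame algorithm is well defined and converges geometrically
    (∀ τ : ℝ, ∀ f ∈ G.paleyWiener ω, ∀ n : ℕ,
      Summable fun v : S₀ => (f - G.frameIterate ω S₀ τ f n : Ell2 V) v • G.theta ω v) ∧
    (∀ τ : ℝ, 0 < τ → τ < 2 / G.upperBound S₀ ω → ∀ f ∈ G.paleyWiener ω, ∀ n : ℕ,
      ‖f - G.frameIterate ω S₀ τ f n‖ ≤
        max |1 - τ * G.lowerBound S₀ ω| |1 - τ * G.upperBound S₀ ω| ^ n * ‖f‖) ∧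
    (∀ f ∈ G.paleyWiener ω, ∀ n : ℕ,
      ‖f - G.frameIterate ω S₀ (2 / (G.lowerBound S₀ ω + G.upperBound S₀ ω)) f n‖ ≤
        ((G.upperBound S₀ ω - G.lowerBound S₀ ω) /
          (G.lowerBound S₀ ω + G.upperBound S₀ ω)) ^ n * ‖f‖) := by
  obtain ⟨hK0, -, hKh, hDh, hKD, hKD', hK1⟩ :=
    WeightedGraph.cut_constants hL.dense_domain hS₁ hω hωK
  have hBpos : 0 < G.upperBound S₀ ω := WeightedGraph.upperBound_pos hKh hDh
  have hA0 : 0 ≤ G.lowerBound S₀ ω := WeightedGraph.lowerBound_nonneg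
  have hAB := WeightedGraph.lowerBound_le_upperBound hω hK1 hKD hKD'
  refine ⟨⟨hA0, hAB, hBpos, fun hD => WeightedGraph.lowerBound_pos hω hK0 hK1 hD.ne⟩,
    fun v => ⟨_, rfl⟩, fun f hf => ?_,
    fun τ f _ n => (WeightedGraph.hasSum_frame G S₀ ω _).summable,
    fun τ hτ _ f hf n =>
      WeightedGraph.norm_sub_frameIterate_le hL hS₁ hω hωK hτ.le hf n,
    fun f hf n => ?_⟩
  · have hin : ∀ v : S₀, inner ℂ (G.theta ω v) f = f v := fun v => WeightedGraph.inner_theta hf v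
    have hsum := Ell2.hasSum_norm_sq (Ell2.restrict S₀ f)
    have hb := WeightedGraph.frame_bounds hL hS₁ hω hωK (WeightedGraph.pwProjection_apply_of_mem hf)
    have htsum : ∑' v : S₀, ‖inner ℂ (G.theta ω v) f‖ ^ 2 = ‖Ell2.restrict S₀ f‖ ^ 2 := by
      rw [← hsum.tsum_eq]
      exact tsum_congr fun v => by rw [hin v, Ell2.restrict_apply]
    rw [htsum]
    exact ⟨hin, hsum.summable, hb⟩
  · have h := WeightedGraph.norm_sub_frameIterate_le hL hS₁ hω hωK
      (τ := 2 / (G.lowerBound S₀ ω + G.upperBound S₀ ω)) (by positivity) hf n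
    -- for this `τ` the two factors `1 - τ A` and `1 - τ B` are opposite
    set A := G.lowerBound S₀ ω
    set B := G.upperBound S₀ ω
    have hpos : 0 < A + B := by linarith
    have e₁ : 1 - 2 / (A + B) * A = (B - A) / (A + B) := by
      field_simp
      ring
    have e₂ : 1 - 2 / (A + B) * B = -((B - A) / (A + B)) := by
      field_simp
      ring
    rwa [e₁, e₂, abs_neg, max_self, abs_of_nonneg (div_nonneg (by linarith) hpos.le)] at h
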